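/- Let $d,n\ge 1$ be integers and $[m]=\{1,\dots,m\}$. Let $p_1,\dots,p_d\in\mathbb R^n$ be probability vectors with positive entries $p_{i,j}$ ($i\in[n]$, $j\in[d]$), $P=(p_1,\dots,p_d)$, and let $\mathcal A=[a_{i_1,\dots,i_d}]$ be a $d$-mode $n\times\cdots\times n$ tensor with positive entries. For such a tensor $\mathcal B$ let $s_l(\mathcal B)\in\mathbb R^n$ be its $l$-th marginal, $s_{i_l,l}(\mathcal B)=\sum_{i_j\in[n],\,j\ne l} b_{i_1,\dots,i_d}$, and let $U(P)$ be the set of nonnegative tensors $\mathcal U$ with $s_j(\mathcal U)=p_j$ for all $j\in[d]$. A scaling of $\mathcal A$ is a tensor of the form $[\exp(\sum_{j=1}^d x_{i_j,j})\,a_{i_1,\dots,i_d}]$ with $x_1,\dots,x_d\in\mathbb R^n$. Put $K(p\|q)=\sum_{i=1}^n p_i(\log p_i-\log q_i)$ and, for $Y=(y_1,\dots,y_d)\in(\mathbb R^n)^d$, $$g_{\mathcal A}(Y)=\sum_{i_1,\dots,i_d\in[n]} a_{i_1,\dots,i_d}\exp\Big(\sum_{j=1}^d y_{i_j,j}\Big)-\sum_{j=1}^d\langle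 p_j,y_j\rangle .$$ The modified Sinkhorn algorithm starts with $X^{(0)}=0\in(\mathbb R^n)^d$. Given $X^{(k)}=(x^{(k)}_1,\dots,x^{(k)}_d)$, $k\ge 0$, let $\mathcal A_k=[\exp(\sum_{j} x^{(k)}_{i_j,j})\,a_{i_1,\dots,i_d}]$, choose a mode $$\ell(k)\in\arg\max_{j\in[d]}\Big\|s_j(\mathcal A_k)-\frac{\langle s_j(\mathcal A_k),p_j\rangle}{\|p_j\|_2^2}\,p_j\Big\|_1$$ (ties broken arbitrarily), and set $x^{(k+1)}_j=x^{(k)}_j$ for $j\ne\ell(k)$ and $x^{(k+1)}_{i,l}=x^{(k)}_{i,l}+\log p_{i,l}-\log s_{i,l}(\mathcal A_k)$ for $l=\ell(k)$, $i\in[n]$. A sequence $u_k$ converges geometrically to $u$ if there are constants $C$ and $r\in(0,1)$ with $\|u_k-u\|\le C r^k$ for all $k$. Then for every sequence generated by the algorithm: (a) there is exactly one scaling $\mathcal U$ of $\mathcal A$ with $\mathcal U\in U(P)$, and $\mathcal A_k$ converges geometrically to $\mathcal U$; (b) for each $j\in[d]$ the sequence $K(p_j\|s_j(\mathcal A_k))$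 converges geometrically to $0$; (c) $X^{(k)}$ converges geometrically to a point $X^\star$ at which $g_{\mathcal A}$ attains its minimum over $(\mathbb R^n)^d$; (d) for every $k\ge 1$, with $l=\ell(k)$, $$g_{\mathcal A}(X^{(k)})-g_{\mathcal A}(X^{(k+1)})=\sum_{j=1}^d\langle p_j,x^{(k+1)}_j-x^{(k)}_j\rangle=\langle p_l,x^{(k+1)}_l-x^{(k)}_l\rangle=K(p_l\|s_l(\mathcal A_k)).$$ -/

import Mathlib

namespace TensorSinkhorn

noncomputable section

/-- Real `d`-mode tensors of size `n × ⋯ × n`; an entry is indexed by `i = (i₁, …, i_d)`. -/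
abbrev Tensor (n d : ℕ) : Type := (Fin d → Fin n) → ℝ

/-- The strictly positive probability vectors of length `n`. -/
def posSimplex (n : ℕ) : Set (Fin n → ℝ) :=
  {q | (∀ a, 0 < q a) ∧ ∑ a, q a = 1}

/-- The `l`-th marginal: `s_l(B)_a` is the sum of all entries of `B` with `l`-th index `a`. -/
def marginal {n d : ℕ} (B : Tensor n d) (l : Fin d) : Fin n → ℝ :=
  fun a => ∑ i : Fin d → Fin n with i l = a, B i

/-- The nonnegative tensors whose `j`-th marginal is `p j` for every mode `j`. -/
def transportPolytope {n d : ℕ} (p : Fin d → Fin n → ℝ) : Set (Tensor n d) :=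
  {U | (∀ i, 0 ≤ U i) ∧ ∀ j, marginal U j = p j}

/-- The scaling of `A` by the potentials `X`, with entries `exp (∑ j, x_{i_j, j}) * a_i`. -/
def scale {n d : ℕ} (A : Tensor n d) (X : Fin d → Fin n → ℝ) : Tensor n d :=
  fun i => Real.exp (∑ j, X j (i j)) * A i

/-- `A` is scalable to `U`. -/
def IsScalableTo {n d : ℕ} (A U : Tensor n d) : Prop :=
  ∃ X : Fin d → Fin n → ℝ, scale A X = U

/-- The Kullback–Leibler divergence `K(q ‖ r)`. -/
def kl {n : ℕ} (q r : Fin n → ℝ) : ℝ :=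
  ∑ a, q a * (Real.log (q a) - Real.log (r a))

/-- The convex function `g_A`. -/
def gFun {n d : ℕ} (p : Fin d → Fin n → ℝ) (A : Tensor n d) (Y : Fin d → Fin n → ℝ) : ℝ :=
  ∑ i : Fin d → Fin n, A i * Real.exp (∑ j, Y j (i j)) - ∑ j, ∑ a, p j a * Y j a

/-- The `ℓ¹` norm of the component of `s_j(B)` orthogonal to `p_j`. -/
def residual {n d : ℕ} (p : Fin d → Fin n → ℝ) (B : Tensor n d) (j : Fin d) : ℝ :=
  ∑ a, |marginal B j a
    - (∑ b, marginal B j b * p j b) / (∑ b, p j b ^ 2) * p j a|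

/-- The potentials `X^(k)` obtained from `X^(0) = 0` when the mode rescaled in the step from `k`
to `k + 1` is `mode k`: to `x_l`, `l = mode k`, one adds `log p_l - log s_l(A_k)`, where `A_k` is
the scaling of `A` by `X^(k)`. -/
def potential {n d : ℕ} (p : Fin d → Fin n → ℝ) (A : Tensor n d) (mode : ℕ → Fin d) :
    ℕ → Fin d → Fin n → ℝ
  | 0 => 0
  | k + 1 =>
    Function.update (potential p A mode k) (mode k) (fun a =>
      (Real.log (p (mode k) a)
        - Real.log (marginal (scale A (potential p A mode k)) (mode k) a))
      + potential p A mode k (mode k) a)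

/-- The tensors `A_k` of the algorithm. -/
def iterate {n d : ℕ} (p : Fin d → Fin n → ℝ) (A : Tensor n d) (mode : ℕ → Fin d) (k : ℕ) :
    Tensor n d :=
  scale A (potential p A mode k)

/-- At every step the rescaled mode maximizes the residual (ties may be broken in any way). -/
def IsGreedy {n d : ℕ} (p : Fin d → Fin n → ℝ) (A : Tensor n d) (mode : ℕ → Fin d) : Prop :=
  ∀ k j, residual p (iterate p A mode k) j ≤ residual p (iterate p A mode k) (mode k)

/-- Geometric (linear) convergence of `u` to `x`. -/
def ConvergesGeometrically {E : Type*} [PseudoMetricSpace E] (u : ℕ → E) (x : E) : Prop :=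
  ∃ C r : ℝ, 0 < r ∧ r < 1 ∧ ∀ k, dist (u k) x ≤ C * r ^ k

end

end TensorSinkhorn

namespace TensorSinkhorn

/-! Each step is an exact block minimization of the convex function `gFun`, and from index 1 on the
iterates have total mass 1. After a rescaling, the new `x_l` is `log p_l` minus the logarithm of a
sum in which only the entries of `A` depend on the `l`-th index. Hence the potentials have uniformly
bounded oscillation, and all later iterates have entries in some `[δ, 1]` with `δ > 0`
(`exists_pos_le_iterate_succ`).

On that region three estimates hold. The gap in `gFun` between two normalized scalings is at most a
constant times the squared marginal `defect` (`gFun_sub_le_sq_defect`). The decrease in one step is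
a Kullback–Leibler divergence, which dominates the squared step length (`sum_sq_log_sub_le_kl`). By
the greedy choice, the error of the chosen marginal controls the whole defect
(`defect_le_of_residual_le`). So each decrease dominates both the remaining gap and the squared
step: values decay geometrically, steps are geometrically summable, and the potentials converge
(`exists_convergesGeometrically_of_descent`). Gaps are only compared between iterates, so no
minimizer is presupposed, and non-uniqueness of minimizers is harmless.

Vanishing steps force the limit to have marginals `p`; convexity makes it a minimizer, and
monotonicity of `log` makes the scaled tensor unique. -/

variable {n d : ℕ}

/-! ### Scalar inequalities for `exp` and `log` -/

lemma one_add_add_sq_div_le_exp {M w : ℝ} (hM : 2 ≤ M) (hw : |w| ≤ M) :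
    1 + w + w ^ 2 / (2 * M) ≤ Real.exp w := by
  have hw' := abs_le.1 hw
  -- For `w ≥ -2`, square `1 + w / 2 ≤ exp (w / 2)`. For `w < -2`, the bound `|w| ≤ M` makes the
  -- left side at most `1 + w / 2 < 0`.
  rcases le_or_gt (-2) w with h | h
  · have h1 : w ^ 2 / (2 * M) ≤ w ^ 2 / 4 :=
      div_le_div_of_nonneg_left (sq_nonneg w) (by norm_num) (by linarith)
    have h2 : (1 + w / 2) ^ 2 ≤ Real.exp w := by
      have h3 : Real.exp w = Real.exp (w / 2) ^ 2 := by
        rw [← Real.exp_nat_mul]; congr 1; push_cast; ring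
      rw [h3]
      have := Real.add_one_le_exp (w / 2)
      exact pow_le_pow_left₀ (by linarith) (by linarith) 2
    nlinarith
  · have h1 : w ^ 2 / (2 * M) ≤ -w / 2 := by
      rw [div_le_div_iff₀ (by linarith) (by norm_num)]
      nlinarith
    have := Real.exp_pos w
    linarith

lemma abs_sub_le_abs_log_sub {x y : ℝ} (hx : 0 < x) (hx1 : x ≤ 1) (hy : 0 < y) (hy1 : y ≤ 1) :
    |x - y| ≤ |Real.log x - Real.log y| := by
  wlog h : y ≤ x generalizing x y
  · rw [abs_sub_comm, abs_sub_comm (Real.log x)]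
    exact this hy hy1 hx hx1 (le_of_not_ge h)
  have h1 : Real.log y ≤ Real.log x := Real.log_le_log hy h
  rw [abs_of_nonneg (by linarith), abs_of_nonneg (by linarith)]
  have h2 := Real.log_le_sub_one_of_pos (div_pos hy hx)
  rw [Real.log_div hy.ne' hx.ne'] at h2
  have h3 : x - y ≤ 1 - y / x := by
    rw [← sub_nonneg]
    have : 1 - y / x - (x - y) = (x - y) * (1 - x) / x := by field_simp
    rw [this]
    exact div_nonneg (mul_nonneg (by linarith) (by linarith)) hx.le
  linarith

lemma abs_log_sub_le {δ x y : ℝ} (hδ : 0 < δ) (hx : δ ≤ x) (hy : δ ≤ y) :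
    |Real.log x - Real.log y| ≤ |x - y| / δ := by
  wlog h : y ≤ x generalizing x y
  · rw [abs_sub_comm, abs_sub_comm x]
    exact this hy hx (le_of_not_ge h)
  have hx' := hδ.trans_le hx
  have hy' := hδ.trans_le hy
  have h1 : Real.log y ≤ Real.log x := Real.log_le_log hy' h
  rw [abs_of_nonneg (by linarith), abs_of_nonneg (by linarith)]
  have h2 := Real.log_le_sub_one_of_pos (div_pos hx' hy')
  rw [Real.log_div hx'.ne' hy'.ne'] at h2
  have h3 : x / y - 1 = (x - y) / y := by field_simp
  have h4 : (x - y) / y ≤ (x - y) / δ :=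
    div_le_div_of_nonneg_left (by linarith) hδ hy
  linarith

lemma abs_log_sub_log_le {δ x y : ℝ} (hδ : 0 < δ) (hx : δ ≤ x) (hx1 : x ≤ 1) (hy : δ ≤ y)
    (hy1 : y ≤ 1) : |Real.log x - Real.log y| ≤ -Real.log δ := by
  have h1 := Real.log_le_log hδ hx
  have h2 := Real.log_le_log hδ hy
  have h3 := Real.log_nonpos (hδ.le.trans hx) hx1
  have h4 := Real.log_nonpos (hδ.le.trans hy) hy1
  rw [abs_le]; constructor <;> linarith

/-! ### Geometric convergence and descent sequences -/

/-- The initial tensor need not have mass 1, so the estimates for the algorithm start at index 1;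
enlarging the constant absorbs index 0. -/
lemma ConvergesGeometrically.of_succ {E : Type*} [PseudoMetricSpace E] {u : ℕ → E} {x : E}
    {C r : ℝ} (hr0 : 0 < r) (hr1 : r < 1) (h : ∀ k, dist (u (k + 1)) x ≤ C * r ^ k) :
    ConvergesGeometrically u x := by
  refine ⟨max (dist (u 0) x) (C / r), r, hr0, hr1, fun k => ?_⟩
  cases k with
  | zero => simp
  | succ k =>
    calc dist (u (k + 1)) x ≤ C / r * r ^ (k + 1) := by
          rw [pow_succ]; convert h k using 1; field_simp
      _ ≤ _ := mul_le_mul_of_nonneg_right (le_max_right _ _) (by positivity)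

lemma ConvergesGeometrically.of_dist_le {E F : Type*} [PseudoMetricSpace E]
    [PseudoMetricSpace F] {u : ℕ → E} {x : E} {v : ℕ → F} {y : F} {K : ℝ} (hK : 0 ≤ K)
    (hu : ConvergesGeometrically u x)
    (h : ∀ k, dist (v (k + 1)) y ≤ K * dist (u (k + 1)) x) : ConvergesGeometrically v y := by
  obtain ⟨C, r, h0, h1, hC⟩ := hu
  refine .of_succ (C := K * (C * r)) h0 h1 fun k => (h k).trans ?_
  calc K * dist (u (k + 1)) x ≤ K * (C * r ^ (k + 1)) := mul_le_mul_of_nonneg_left (hC _) hK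
    _ = _ := by ring

lemma ConvergesGeometrically.tendsto {E : Type*} [PseudoMetricSpace E] {u : ℕ → E} {x : E}
    (h : ConvergesGeometrically u x) : Filter.Tendsto u Filter.atTop (nhds x) := by
  obtain ⟨C, r, h0, h1, hC⟩ := h
  rw [tendsto_iff_dist_tendsto_zero]
  refine squeeze_zero (fun _ => dist_nonneg) hC ?_
  simpa using (tendsto_pow_atTop_nhds_zero_of_lt_one h0.le h1).const_mul C

/-- A descent sequence whose decrease dominates both the squared step length and the total
remaining decrease converges geometrically. -/
lemma exists_convergesGeometrically_of_descent {E : Type*} [PseudoMetricSpace E] [CompleteSpace E]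
    {u : ℕ → E} {G : ℕ → ℝ} {C₁ C₂ : ℝ}
    (hstep : ∀ k, dist (u k) (u (k + 1)) ^ 2 ≤ C₁ * (G k - G (k + 1)))
    (hgap : ∀ k m, k ≤ m → G k - G m ≤ C₂ * (G k - G (k + 1)))
    (hanti : Antitone G) : ∃ x, ∃ C r : ℝ, 0 < r ∧ r < 1 ∧ ∀ k, dist (u k) x ≤ C * r ^ k := by
  have hbdd : BddBelow (Set.range G) := by
    refine ⟨G 0 - C₂ * (G 0 - G 1), ?_⟩
    rintro _ ⟨m, rfl⟩
    have := hgap 0 m (Nat.zero_le m)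
    simp only [zero_add] at this
    linarith
  set g := ⨅ k, G k
  have hlim : Filter.Tendsto G Filter.atTop (nhds g) := tendsto_atTop_ciInf hanti hbdd
  have hg : ∀ k, g ≤ G k := fun k => ciInf_le hbdd k
  -- The lower bound 2 keeps the contraction factor `1 - 1 / K` in `[1/2, 1)`, whatever the value of
  -- `C₂`.
  set K := max C₂ 2
  have hK : 2 ≤ K := le_max_right _ _
  have hgap' : ∀ k, G k - g ≤ K * (G k - G (k + 1)) := by
    intro k
    have h1 : G k - g ≤ C₂ * (G k - G (k + 1)) :=
      le_of_tendsto (tendsto_const_nhds.sub hlim)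
        (Filter.eventually_atTop.2 ⟨k, fun m hm => hgap k m hm⟩)
    exact h1.trans (mul_le_mul_of_nonneg_right (le_max_left _ _)
      (sub_nonneg.2 (hanti k.le_succ)))
  set q := 1 - 1 / K
  have hq0 : 0 < q := by
    have : 1 / K ≤ 1 / 2 := one_div_le_one_div_of_le (by norm_num) hK
    simp only [q]; linarith
  have hq1 : q < 1 := by
    have : 0 < 1 / K := by positivity
    simp only [q]; linarith
  have hrate : ∀ k, G k - g ≤ (G 0 - g) * q ^ k := by
    intro k
    induction k with
    | zero => simp
    | succ k ih =>
      have h1 : G (k + 1) - g ≤ (G k - g) * q := by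
        have h2 : (G k - g) / K ≤ G k - G (k + 1) := by
          rw [div_le_iff₀ (by linarith)]; linarith [hgap' k]
        have h3 : (G k - g) * q = (G k - g) - (G k - g) / K := by simp only [q]; ring
        linarith
      calc _ ≤ _ := h1
        _ ≤ (G 0 - g) * q ^ k * q := mul_le_mul_of_nonneg_right ih hq0.le
        _ = _ := by ring
  set B := max C₁ 0 * (G 0 - g)
  have hB : 0 ≤ B := mul_nonneg (le_max_right _ _) (sub_nonneg.2 (hg 0))
  -- Values decay like `q ^ k` and bound squared steps, so the steps themselves decay at rate `√q`.
  have hdist : ∀ k, dist (u k) (u (k + 1)) ≤ √B * √q ^ k := by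
    intro k
    refine abs_le_of_sq_le_sq' ?_ (by positivity) |>.2
    have h1 : (√B * √q ^ k) ^ 2 = B * q ^ k := by
      rw [mul_pow, Real.sq_sqrt hB, ← pow_mul, mul_comm k 2, pow_mul, Real.sq_sqrt hq0.le]
    rw [h1]
    calc _ ≤ _ := hstep k
      _ ≤ max C₁ 0 * (G k - G (k + 1)) := mul_le_mul_of_nonneg_right (le_max_left _ _)
        (sub_nonneg.2 (hanti k.le_succ))
      _ ≤ max C₁ 0 * ((G 0 - g) * q ^ k) := mul_le_mul_of_nonneg_left
        (by linarith [hrate k, hg (k + 1)]) (le_max_right _ _)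
      _ = _ := by simp only [B]; ring
  have hr1 : √q < 1 := by rw [Real.sqrt_lt' one_pos]; simpa using hq1
  obtain ⟨x, hx⟩ := cauchySeq_tendsto_of_complete (cauchySeq_of_le_geometric _ _ hr1 hdist)
  refine ⟨x, √B / (1 - √q), √q, Real.sqrt_pos.2 hq0, hr1, fun k => ?_⟩
  convert dist_le_of_le_geometric_of_tendsto _ _ hr1 hdist hx k using 1
  ring

/-! ### Marginals and scalings of tensors -/

lemma sum_marginal_mul (B : Tensor n d) (j : Fin d) (f : Fin n → ℝ) :
    ∑ a, marginal B j a * f a = ∑ i, B i * f (i j) := by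
  rw [← Finset.sum_fiberwise Finset.univ (fun i : Fin d → Fin n => i j)]
  refine Finset.sum_congr rfl fun a _ => ?_
  rw [marginal, Finset.sum_mul]
  refine Finset.sum_congr rfl fun i hi => ?_
  rw [(Finset.mem_filter.1 hi).2]

lemma sum_marginal (B : Tensor n d) (j : Fin d) : ∑ a, marginal B j a = ∑ i, B i := by
  simpa using sum_marginal_mul B j 1

lemma sum_sum_marginal_mul (B : Tensor n d) (D : Fin d → Fin n → ℝ) :
    ∑ j, ∑ a, marginal B j a * D j a = ∑ i, B i * ∑ j, D j (i j) := by
  simp only [sum_marginal_mul, Finset.mul_sum]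
  exact Finset.sum_comm

lemma le_marginal {B : Tensor n d} {δ : ℝ} (h0 : ∀ i, 0 ≤ B i) (h : ∀ i, δ ≤ B i)
    (j : Fin d) (a : Fin n) : δ ≤ marginal B j a :=
  (h fun _ => a).trans (Finset.single_le_sum (f := B) (fun i _ => h0 i) (by simp))

lemma marginal_pos {B : Tensor n d} (h : ∀ i, 0 < B i) (j : Fin d) (a : Fin n) :
    0 < marginal B j a :=
  Finset.sum_pos (fun i _ => h i) ⟨fun _ => a, by simp⟩

lemma le_sum_entries {ι : Type*} [Fintype ι] {f : ι → ℝ} (h : ∀ i, 0 ≤ f i) (i : ι) :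
    f i ≤ ∑ j, f j :=
  Finset.single_le_sum (f := f) (fun i _ => h i) (Finset.mem_univ i)

/-- Changing one index isolates a difference of values within a single mode, which is free of the
additive constants that may be shifted between modes. -/
lemma sum_update (D : Fin d → Fin n → ℝ) (i : Fin d → Fin n) (l : Fin d) (b : Fin n) :
    ∑ j, D j (Function.update i l b j) = ∑ j, D j (i j) + (D l b - D l (i l)) := by
  rw [← sub_eq_iff_eq_add', ← Finset.sum_sub_distrib, Finset.sum_eq_single l]
  · simp
  · intro j _ hj; simp [hj]
  · simp

lemma marginal_eq_sum_update (B : Tensor n d) (l : Fin d) (a b : Fin n) :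
    marginal B l b = ∑ i : Fin d → Fin n with i l = a, B (Function.update i l b) := by
  refine Finset.sum_nbij' (fun i => Function.update i l a) (fun i => Function.update i l b)
    ?_ ?_ ?_ ?_ ?_
  · simp
  · simp
  · intro i hi
    have : i l = b := by simpa using hi
    simp [← this]
  · intro i hi
    have : i l = a := by simpa using hi
    simp [← this]
  · intro i hi
    have : i l = b := by simpa using hi
    simp [← this]

lemma scale_pos {A : Tensor n d} (hA : ∀ i, 0 < A i) (X : Fin d → Fin n → ℝ) (i) :
    0 < scale A X i := mul_pos (Real.exp_pos _) (hA i)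

lemma log_scale {A : Tensor n d} (hA : ∀ i, 0 < A i) (X : Fin d → Fin n → ℝ) (i) :
    Real.log (scale A X i) = ∑ j, X j (i j) + Real.log (A i) := by
  rw [scale, Real.log_mul (Real.exp_ne_zero _) (hA i).ne', Real.log_exp]

lemma log_scale_sub {A : Tensor n d} (hA : ∀ i, 0 < A i) (X Y : Fin d → Fin n → ℝ) (i) :
    Real.log (scale A Y i) - Real.log (scale A X i) = ∑ j, (Y - X) j (i j) := by
  rw [log_scale hA, log_scale hA]
  simp only [Pi.sub_apply, Finset.sum_sub_distrib]
  ring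

lemma gFun_eq (p : Fin d → Fin n → ℝ) (A : Tensor n d) (X : Fin d → Fin n → ℝ) :
    gFun p A X = ∑ i, scale A X i - ∑ j, ∑ a, p j a * X j a := by
  simp only [gFun, scale, mul_comm]

lemma gFun_sub_gFun (p : Fin d → Fin n → ℝ) (A : Tensor n d) (X Y : Fin d → Fin n → ℝ)
    (h : ∑ i, scale A X i = ∑ i, scale A Y i) :
    gFun p A X - gFun p A Y = ∑ j, ∑ a, p j a * (Y - X) j a := by
  rw [gFun_eq, gFun_eq, h]
  simp only [Pi.sub_apply, mul_sub, Finset.sum_sub_distrib]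
  ring

lemma scale_eq_mul_exp {A : Tensor n d} (X Y : Fin d → Fin n → ℝ) (i) :
    scale A Y i = scale A X i * Real.exp (∑ j, (Y - X) j (i j)) := by
  simp only [scale, Pi.sub_apply, Finset.sum_sub_distrib, Real.exp_sub]
  field_simp

/-! ### Gap estimate, minimality and uniqueness -/

/-- The sum of the `ℓ¹` norms of the partial gradients of `g_A`, at a scaling equal to `B`. -/
noncomputable def defect (p : Fin d → Fin n → ℝ) (B : Tensor n d) : ℝ :=
  ∑ j, ∑ a, |marginal B j a - p j a|

/-- A Polyak–Łojasiewicz inequality for `g_A`. -/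
lemma gFun_sub_le_sq_defect {p : Fin d → Fin n → ℝ} (hp : ∀ j, ∑ a, p j a = 1)
    {A : Tensor n d} (hA : ∀ i, 0 < A i) {X Y : Fin d → Fin n → ℝ} {δ M : ℝ} (hδ : 0 < δ)
    (hM : 2 ≤ M) (hMδ : -Real.log δ ≤ M)
    (hX : ∀ i, δ ≤ scale A X i) (hX1 : ∑ i, scale A X i = 1)
    (hY : ∀ i, δ ≤ scale A Y i) (hY1 : ∑ i, scale A Y i = 1) :
    gFun p A X - gFun p A Y ≤ (2 * M / δ) * defect p (scale A X) ^ 2 := by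
  have hle : ∀ Z : Fin d → Fin n → ℝ, ∑ i, scale A Z i = 1 → ∀ i, scale A Z i ≤ 1 :=
    fun Z hZ i => hZ ▸ le_sum_entries (fun i => (scale_pos hA Z i).le) i
  have hne : Nonempty (Fin d → Fin n) := by
    by_contra h
    rw [not_nonempty_iff] at h
    simp at hX1
  set w : Tensor n d := fun i => ∑ j, (Y - X) j (i j)
  obtain ⟨i₀, hi₀⟩ := Finite.exists_max fun i => |w i|
  have hw : ∀ i, |w i| ≤ M := fun i => by
    simp only [w]
    rw [← log_scale_sub hA]
    exact (abs_log_sub_log_le hδ (hY i) (hle Y hY1 i) (hX i) (hle X hX1 i)).trans hMδ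
  set α := δ / (2 * M) with hα
  have hαpos : 0 < α := by positivity
  -- Both scalings have mass 1, so the average of `exp w` against `scale A X` is 1; the quadratic
  -- lower bound for `exp` leaves a strictly convex remainder, of which only the term at `i₀` is
  -- kept.
  have h1 : ∑ i, scale A X i * w i + α * |w i₀| ^ 2 ≤ 0 := by
    have h2 : ∑ i, scale A X i * (1 + w i + w i ^ 2 / (2 * M)) ≤ 1 := by
      refine (Finset.sum_le_sum fun i _ => ?_).trans hY1.le
      rw [scale_eq_mul_exp X Y]
      exact mul_le_mul_of_nonneg_left (one_add_add_sq_div_le_exp hM (hw i)) (scale_pos hA X i).le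
    have h3 : α * |w i₀| ^ 2 ≤ ∑ i, scale A X i * (w i ^ 2 / (2 * M)) := by
      refine le_trans ?_ (le_sum_entries (fun i => mul_nonneg (scale_pos hA X i).le
        (by positivity)) i₀)
      rw [sq_abs, hα, div_mul_eq_mul_div, ← mul_div_assoc]
      gcongr
      exact hX i₀
    simp only [mul_add, mul_one, Finset.sum_add_distrib, hX1] at h2
    linarith
  have h4 : ∑ j, ∑ a, (p j a - marginal (scale A X) j a) * (Y - X) j a
      ≤ 2 * |w i₀| * defect p (scale A X) := by
    rw [defect, Finset.mul_sum]
    refine Finset.sum_le_sum fun j _ => ?_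
    -- Each marginal error sums to zero, so a constant may be subtracted in each mode. The resulting
    -- differences are differences of two values of `w`, hence at most `2 * |w i₀|`.
    have h5 : ∑ a, (p j a - marginal (scale A X) j a) * (Y - X) j a
        = ∑ a, (p j a - marginal (scale A X) j a) * ((Y - X) j a - (Y - X) j (i₀ j)) := by
      simp only [mul_sub (_ - _), Finset.sum_sub_distrib]
      rw [← Finset.sum_mul, Finset.sum_sub_distrib, hp, sum_marginal, hX1]
      simp
    rw [h5, Finset.mul_sum]
    refine Finset.sum_le_sum fun a _ => (le_abs_self _).trans ?_
    rw [abs_mul, mul_comm, abs_sub_comm (p j a)]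
    refine mul_le_mul_of_nonneg_right ?_ (abs_nonneg _)
    have h6 := sum_update (Y - X) i₀ j a
    have h7 : (Y - X) j a - (Y - X) j (i₀ j) = w (Function.update i₀ j a) - w i₀ := by
      simp only [w]; linarith
    rw [h7]
    refine (abs_sub _ _).trans ?_
    linarith [hi₀ (Function.update i₀ j a)]
  have h8 := sum_sum_marginal_mul (scale A X) (Y - X)
  rw [gFun_sub_gFun p A X Y (hX1.trans hY1.symm)]
  simp only [sub_mul, Finset.sum_sub_distrib] at h4
  -- Completing the square eliminates the unknown size of `w`.
  have h9 : 2 * |w i₀| * defect p (scale A X) - α * |w i₀| ^ 2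
      ≤ α⁻¹ * defect p (scale A X) ^ 2 := by
    have h10 : 0 ≤ α⁻¹ * (α * |w i₀| - defect p (scale A X)) ^ 2 := by positivity
    have h11 : α⁻¹ * (α * |w i₀| - defect p (scale A X)) ^ 2 = α * |w i₀| ^ 2
        - 2 * |w i₀| * defect p (scale A X) + α⁻¹ * defect p (scale A X) ^ 2 := by
      field_simp
      ring
    linarith
  have h12 : α⁻¹ = 2 * M / δ := by rw [hα, inv_div]
  rw [← h12]
  linarith

/-- A scaling with the prescribed marginals yields a minimizer of `g_A`. -/
lemma gFun_le_of_marginal_eq {p : Fin d → Fin n → ℝ} {A : Tensor n d} (hA : ∀ i, 0 < A i)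
    {X : Fin d → Fin n → ℝ} (hX : ∀ j, marginal (scale A X) j = p j) (Y : Fin d → Fin n → ℝ) :
    gFun p A X ≤ gFun p A Y := by
  have h1 : ∑ i, scale A X i + ∑ i, scale A X i * ∑ j, (Y - X) j (i j) ≤ ∑ i, scale A Y i := by
    rw [← Finset.sum_add_distrib]
    refine Finset.sum_le_sum fun i _ => ?_
    rw [scale_eq_mul_exp X Y]
    nlinarith [Real.add_one_le_exp (∑ j, (Y - X) j (i j)), scale_pos hA X i]
  rw [← sum_sum_marginal_mul] at h1
  simp only [hX, Pi.sub_apply, mul_sub, Finset.sum_sub_distrib] at h1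
  rw [gFun_eq, gFun_eq]
  linarith

/-- The difference of the two tensors is orthogonal to every sum of functions of single indices, in
particular to the difference of their logarithms. As `log` is monotone, each term of that pairing is
nonnegative, hence zero. -/
lemma scale_eq_of_marginal_eq {A : Tensor n d} (hA : ∀ i, 0 < A i) {X Y : Fin d → Fin n → ℝ}
    (h : ∀ j, marginal (scale A X) j = marginal (scale A Y) j) : scale A X = scale A Y := by
  have h1 := sum_sum_marginal_mul (scale A X) (Y - X)
  have h2 := sum_sum_marginal_mul (scale A Y) (Y - X)
  simp only [h] at h1
  have h3 : ∑ i, (scale A Y i - scale A X i) * ∑ j, (Y - X) j (i j) = 0 := by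
    simp only [sub_mul, Finset.sum_sub_distrib] at h1 h2 ⊢
    linarith
  have h4 : ∀ i, 0 ≤ (scale A Y i - scale A X i) * ∑ j, (Y - X) j (i j) := fun i => by
    rw [← log_scale_sub hA]
    rcases le_total (scale A X i) (scale A Y i) with h | h
    · exact mul_nonneg (by linarith) (sub_nonneg.2 (Real.log_le_log (scale_pos hA X i) h))
    · exact mul_nonneg_of_nonpos_of_nonpos (by linarith)
        (sub_nonpos.2 (Real.log_le_log (scale_pos hA Y i) h))
  ext i
  have h5 := (Finset.sum_eq_zero_iff_of_nonneg fun i _ => h4 i).1 h3 i (Finset.mem_univ i)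
  rcases mul_eq_zero.1 h5 with h6 | h6
  · linarith
  · rw [scale_eq_mul_exp X Y, h6]; simp

end TensorSinkhorn

namespace TensorSinkhorn

variable {n d : ℕ}

/-! ### Residuals, marginal errors and divergence -/

/-- The projection coefficient `c` satisfies `1 - c = ⟨q - s, q⟩ / ‖q‖²`, and Cauchy–Schwarz gives
`‖q‖² ≥ 1 / n`; this produces the factor `1 + n`. -/
lemma residual_le {q : Fin n → ℝ} (hq : q ∈ posSimplex n) (s : Fin n → ℝ) :
    ∑ a, |s a - (∑ b, s b * q b) / (∑ b, q b ^ 2) * q a| ≤ (1 + n) * ∑ a, |s a - q a| := by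
  obtain ⟨hq0, hq1⟩ := hq
  have hle : ∀ a, q a ≤ 1 := fun a => hq1 ▸ le_sum_entries (fun a => (hq0 a).le) a
  set Q := ∑ b, q b ^ 2
  have hcs : 1 ≤ (n : ℝ) * Q := by
    have := sq_sum_le_card_mul_sum_sq (s := Finset.univ) (f := q)
    simpa [hq1] using this
  have hQ : 0 < Q := by
    have hn : (0 : ℝ) ≤ n := n.cast_nonneg
    by_contra h
    nlinarith
  have hQn : 1 / Q ≤ n := by rw [div_le_iff₀ hQ]; exact hcs
  set c := (∑ b, s b * q b) / Q
  set T := ∑ a, |s a - q a|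
  have hT : 0 ≤ T := Finset.sum_nonneg fun _ _ => abs_nonneg _
  have hc : |1 - c| ≤ n * T := by
    have h1 : 1 - c = (∑ b, (q b - s b) * q b) / Q := by
      simp only [c, sub_mul, Finset.sum_sub_distrib, sub_div]
      congr 1
      rw [eq_div_iff hQ.ne', one_mul]
      exact Finset.sum_congr rfl fun b _ => sq (q b)
    have h2 : |∑ b, (q b - s b) * q b| ≤ T := by
      refine (Finset.abs_sum_le_sum_abs _ _).trans (Finset.sum_le_sum fun b _ => ?_)
      rw [abs_mul, abs_of_pos (hq0 b), abs_sub_comm]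
      exact mul_le_of_le_one_right (abs_nonneg _) (hle b)
    rw [h1, abs_div, abs_of_pos hQ, div_eq_mul_one_div, mul_comm]
    exact mul_le_mul hQn h2 (abs_nonneg _) n.cast_nonneg
  calc _ ≤ ∑ a, (|s a - q a| + |1 - c| * q a) := by
        refine Finset.sum_le_sum fun a _ => ?_
        have h : s a - c * q a = (s a - q a) + (1 - c) * q a := by ring
        rw [h]
        refine (abs_add_le _ _).trans_eq ?_
        rw [abs_mul, abs_of_pos (hq0 a)]
    _ = T + |1 - c| := by rw [Finset.sum_add_distrib, ← Finset.mul_sum, hq1, mul_one]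
    _ ≤ _ := by linarith

/-- Equal masses give `1 - c = ∑ (s - c q)`, so the residual itself bounds the error of the
coefficient, for any `c`. -/
lemma le_two_mul_residual {q : Fin n → ℝ} (hq : q ∈ posSimplex n) {s : Fin n → ℝ}
    (hs : ∑ a, s a = 1) (c : ℝ) : ∑ a, |s a - q a| ≤ 2 * ∑ a, |s a - c * q a| := by
  obtain ⟨hq0, hq1⟩ := hq
  have hc : |1 - c| ≤ ∑ a, |s a - c * q a| := by
    have h : 1 - c = ∑ a, (s a - c * q a) := by
      rw [Finset.sum_sub_distrib, ← Finset.mul_sum, hs, hq1, mul_one]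
    rw [h]
    exact Finset.abs_sum_le_sum_abs _ _
  calc _ ≤ ∑ a, (|s a - c * q a| + |1 - c| * q a) := by
        refine Finset.sum_le_sum fun a _ => ?_
        have h : s a - q a = (s a - c * q a) - (1 - c) * q a := by ring
        rw [h]
        refine (abs_sub _ _).trans_eq ?_
        rw [abs_mul, abs_of_pos (hq0 a)]
    _ = ∑ a, |s a - c * q a| + |1 - c| := by
        rw [Finset.sum_add_distrib, ← Finset.mul_sum, hq1, mul_one]
    _ ≤ _ := by linarith

/-- If `l` maximizes the residual, its marginal error controls those of all the modes. -/
lemma defect_le_of_residual_le {p : Fin d → Fin n → ℝ} (hp : ∀ j, p j ∈ posSimplex n)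
    {B : Tensor n d} (hB : ∑ i, B i = 1) {l : Fin d} (hl : ∀ j, residual p B j ≤ residual p B l) :
    defect p B ≤ d * (2 * ((1 + n) * ∑ a, |marginal B l a - p l a|)) := by
  have h : ∀ j ∈ Finset.univ, ∑ a, |marginal B j a - p j a|
      ≤ 2 * ((1 + n) * ∑ a, |marginal B l a - p l a|) := fun j _ =>
    (le_two_mul_residual (hp j) ((sum_marginal B j).trans hB) _).trans
      (mul_le_mul_of_nonneg_left ((hl j).trans (residual_le (hp l) _)) zero_le_two)
  simpa [defect] using Finset.sum_le_card_nsmul _ _ _ h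

/-- A quadratic lower bound for the Kullback–Leibler divergence. -/
lemma sum_sq_log_sub_le_kl {q s : Fin n → ℝ} {δ M : ℝ} (hδ : 0 < δ) (hM : 2 ≤ M)
    (hMδ : -Real.log δ ≤ M) (hq : ∀ a, δ ≤ q a) (hs : ∀ a, δ ≤ s a)
    (hq1 : ∑ a, q a = 1) (hs1 : ∑ a, s a = 1) :
    ∑ a, (Real.log (q a) - Real.log (s a)) ^ 2 ≤ (2 * M / δ) * kl q s := by
  have hqle : ∀ a, q a ≤ 1 := fun a => hq1 ▸ le_sum_entries (fun a => hδ.le.trans (hq a)) a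
  have hsle : ∀ a, s a ≤ 1 := fun a => hs1 ▸ le_sum_entries (fun a => hδ.le.trans (hs a)) a
  -- The quadratic bound for `exp` at `log (s a / q a)`, weighted by `q a`; the linear term sums to
  -- `-kl q s` and the constants cancel.
  have h1 : ∑ a, q a * (1 + (Real.log (s a) - Real.log (q a))
      + (Real.log (s a) - Real.log (q a)) ^ 2 / (2 * M)) ≤ ∑ a, s a := by
    refine Finset.sum_le_sum fun a _ => ?_
    have h2 := one_add_add_sq_div_le_exp hM
      ((abs_log_sub_log_le hδ (hs a) (hsle a) (hq a) (hqle a)).trans hMδ)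
    have hq0 := hδ.trans_le (hq a)
    rw [Real.exp_sub, Real.exp_log hq0, Real.exp_log (hδ.trans_le (hs a)), le_div_iff₀ hq0] at h2
    linarith
  have h3 : ∑ a, δ / (2 * M) * (Real.log (q a) - Real.log (s a)) ^ 2
      ≤ ∑ a, q a * ((Real.log (s a) - Real.log (q a)) ^ 2 / (2 * M)) := by
    refine Finset.sum_le_sum fun a _ => ?_
    rw [div_mul_eq_mul_div, ← mul_div_assoc, sub_sq_comm]
    gcongr
    exact hq a
  have h4 : kl q s = - ∑ a, q a * (Real.log (s a) - Real.log (q a)) := by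
    rw [kl, ← Finset.sum_neg_distrib]
    exact Finset.sum_congr rfl fun a _ => by ring
  simp only [mul_add, mul_one, Finset.sum_add_distrib, hq1, hs1] at h1
  rw [← Finset.mul_sum] at h3
  have h5 : δ / (2 * M) * ∑ a, (Real.log (q a) - Real.log (s a)) ^ 2 ≤ kl q s := by linarith
  rw [div_mul_eq_mul_div, div_le_iff₀ (by linarith)] at h5
  rw [div_mul_eq_mul_div, le_div_iff₀ hδ]
  linarith

/-! ### The iteration: compactness, descent, convergence -/

section Iteration

variable {p : Fin d → Fin n → ℝ} {A : Tensor n d} {mode : ℕ → Fin d}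

lemma iterate_pos (hA : ∀ i, 0 < A i) (k : ℕ) (i : Fin d → Fin n) : 0 < iterate p A mode k i :=
  scale_pos hA _ i

lemma potential_succ_mode (k : ℕ) (a : Fin n) :
    potential p A mode (k + 1) (mode k) a = (Real.log (p (mode k) a)
      - Real.log (marginal (iterate p A mode k) (mode k) a)) + potential p A mode k (mode k) a := by
  simp [potential, iterate]

lemma potential_succ_of_ne (k : ℕ) {j : Fin d} (h : j ≠ mode k) :
    potential p A mode (k + 1) j = potential p A mode k j := by
  simp [potential, h]

lemma sum_potential_succ_sub (k : ℕ) (f : Fin d → ℝ → ℝ) (hf : ∀ j, f j 0 = 0) (i : Fin d → Fin n) :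
    ∑ j, f j (potential p A mode (k + 1) j (i j) - potential p A mode k j (i j))
      = f (mode k) (Real.log (p (mode k) (i (mode k)))
        - Real.log (marginal (iterate p A mode k) (mode k) (i (mode k)))) := by
  rw [Finset.sum_eq_single (mode k)]
  · rw [potential_succ_mode, add_sub_cancel_right]
  · intro j _ hj
    rw [potential_succ_of_ne k hj, sub_self, hf]
  · simp

lemma iterate_succ (hp : ∀ j, p j ∈ posSimplex n) (hA : ∀ i, 0 < A i) (k : ℕ)
    (i : Fin d → Fin n) : iterate p A mode (k + 1) i = iterate p A mode k i
      * (p (mode k) (i (mode k)) / marginal (iterate p A mode k) (mode k) (i (mode k))) := by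
  rw [iterate, scale_eq_mul_exp (potential p A mode k)]
  simp only [Pi.sub_apply]
  rw [sum_potential_succ_sub k (fun _ x => x) (fun _ => rfl) i, Real.exp_sub,
    Real.exp_log ((hp _).1 _), Real.exp_log (marginal_pos (iterate_pos hA _) _ _), ← iterate]

lemma marginal_iterate_succ (hp : ∀ j, p j ∈ posSimplex n) (hA : ∀ i, 0 < A i) (k : ℕ) :
    marginal (iterate p A mode (k + 1)) (mode k) = p (mode k) := by
  ext a
  have h : marginal (iterate p A mode (k + 1)) (mode k) a
      = ∑ i : Fin d → Fin n with i (mode k) = a, iterate p A mode k i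
        * (p (mode k) a / marginal (iterate p A mode k) (mode k) a) := by
    refine Finset.sum_congr rfl fun i hi => ?_
    rw [iterate_succ hp hA, (Finset.mem_filter.1 hi).2]
  rw [h, ← Finset.sum_mul]
  exact mul_div_cancel₀ _ (marginal_pos (iterate_pos hA _) _ _).ne'

lemma sum_iterate_succ (hp : ∀ j, p j ∈ posSimplex n) (hA : ∀ i, 0 < A i) (k : ℕ) :
    ∑ i, iterate p A mode (k + 1) i = 1 := by
  rw [← sum_marginal _ (mode k), marginal_iterate_succ hp hA, (hp _).2]

/-- The oscillation of each potential stays bounded along the iteration. -/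
lemma exists_potential_sub_le (hA : ∀ i, 0 < A i) :
    ∃ R, ∀ k j a b, potential p A mode k j a - potential p A mode k j b ≤ R := by
  set Q := ∑ i, |Real.log (A i)|
  set P := ∑ j, ∑ a, |Real.log (p j a)|
  have hQ : ∀ i, |Real.log (A i)| ≤ Q := le_sum_entries fun _ => abs_nonneg _
  have hP : ∀ j a, |Real.log (p j a)| ≤ P := fun j a =>
    (le_sum_entries (f := fun a => |Real.log (p j a)|) (fun _ => abs_nonneg _) a).trans
      (le_sum_entries (f := fun j => ∑ a, |Real.log (p j a)|)
        (fun _ => Finset.sum_nonneg fun _ _ => abs_nonneg _) j)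
  refine ⟨2 * P + 2 * Q, fun k => ?_⟩
  induction k with
  | zero =>
    intro j a b
    have h1 : 0 ≤ P := (abs_nonneg _).trans (hP j a)
    have h2 : 0 ≤ Q := (abs_nonneg _).trans (hQ fun _ => a)
    simp only [potential, Pi.zero_apply, sub_zero]
    linarith
  | succ k ih =>
    intro j a b
    by_cases hj : j = mode k
    swap
    · rw [potential_succ_of_ne k hj]; exact ih j a b
    subst hj
    rw [potential_succ_mode, potential_succ_mode]
    set l := mode k
    set X := potential p A mode k
    have hpa := abs_le.1 (hP l a)
    have hpb := abs_le.1 (hP l b)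
    have hsa : 0 < marginal (iterate p A mode k) l a := marginal_pos (iterate_pos hA _) _ _
    have hsb : 0 < marginal (iterate p A mode k) l b := marginal_pos (iterate_pos hA _) _ _
    -- Entries in the slices `b` and `a` that agree in all other indices differ only through `X l`
    -- and `A`. The factor `exp (X l b - X l a)` cancels against the old potential in the update, so
    -- the new oscillation is bounded without using `ih`.
    have h1 : marginal (iterate p A mode k) l b
        ≤ Real.exp (2 * Q + X l b - X l a) * marginal (iterate p A mode k) l a := by
      rw [marginal_eq_sum_update _ l a b, marginal, Finset.mul_sum]
      refine Finset.sum_le_sum fun i hi => ?_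
      have hi' : i l = a := (Finset.mem_filter.1 hi).2
      rw [← Real.log_le_log_iff (iterate_pos hA _ _)
        (mul_pos (Real.exp_pos _) (iterate_pos hA _ _)), Real.log_mul (Real.exp_ne_zero _)
        (iterate_pos hA _ _).ne', Real.log_exp, iterate, log_scale hA, log_scale hA,
        sum_update, hi']
      have := abs_le.1 (hQ i)
      have := abs_le.1 (hQ (Function.update i l b))
      linarith
    have h2 := Real.log_le_log hsb h1
    rw [Real.log_mul (Real.exp_ne_zero _) hsa.ne', Real.log_exp] at h2
    linarith

/-- Bounded oscillation makes any two entries comparable up to a fixed factor; since the entries sum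
to 1, none can be small. -/
lemma exists_pos_le_iterate_succ (hp : ∀ j, p j ∈ posSimplex n) (hA : ∀ i, 0 < A i) :
    ∃ δ, 0 < δ ∧ ∀ k i, δ ≤ iterate p A mode (k + 1) i := by
  obtain ⟨R, hR⟩ := exists_potential_sub_le (p := p) (mode := mode) hA
  set Q := ∑ i, |Real.log (A i)|
  have hQ : ∀ i, |Real.log (A i)| ≤ Q := le_sum_entries fun _ => abs_nonneg _
  set N : ℝ := ((Fintype.card (Fin d → Fin n) : ℕ) : ℝ)
  have hcmp : ∀ k i i', iterate p A mode k i'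
      ≤ Real.exp (2 * Q + d * R) * iterate p A mode k i := by
    intro k i i'
    rw [← Real.log_le_log_iff (iterate_pos hA _ _)
      (mul_pos (Real.exp_pos _) (iterate_pos hA _ _)), Real.log_mul (Real.exp_ne_zero _)
      (iterate_pos hA _ _).ne', Real.log_exp, iterate, log_scale hA, log_scale hA]
    have h1 := abs_le.1 (hQ i)
    have h2 := abs_le.1 (hQ i')
    have h3 : ∑ j, (potential p A mode k j (i' j) - potential p A mode k j (i j)) ≤ d * R := by
      simpa using Finset.sum_le_card_nsmul Finset.univ _ _ fun j _ => hR k j (i' j) (i j)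
    rw [Finset.sum_sub_distrib] at h3
    linarith
  have hsum : ∀ k i, 1 ≤ N * (Real.exp (2 * Q + d * R) * iterate p A mode (k + 1) i) := by
    intro k i
    rw [← sum_iterate_succ (mode := mode) hp hA k]
    simpa [N] using Finset.sum_le_card_nsmul Finset.univ _ _ fun i' _ => hcmp (k + 1) i i'
  rcases isEmpty_or_nonempty (Fin d → Fin n) with h | h
  · exact ⟨1, one_pos, fun _ i => h.elim i⟩
  have hN : 0 < N := Nat.cast_pos.2 Fintype.card_pos
  refine ⟨1 / (N * Real.exp (2 * Q + d * R)), by positivity, fun k i => ?_⟩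
  rw [div_le_iff₀ (by positivity)]
  linarith [hsum k i]

lemma sum_mul_potential_succ_sub (k : ℕ) :
    ∑ j, ∑ a, p j a * (potential p A mode (k + 1) j a - potential p A mode k j a)
      = ∑ a, p (mode k) a * (potential p A mode (k + 1) (mode k) a
        - potential p A mode k (mode k) a) := by
  refine Finset.sum_eq_single (mode k) (fun j _ hj => ?_) (by simp)
  simp [potential_succ_of_ne k hj]

lemma sum_mode_mul_potential_succ_sub (k : ℕ) :
    ∑ a, p (mode k) a * (potential p A mode (k + 1) (mode k) a - potential p A mode k (mode k) a)
      = kl (p (mode k)) (marginal (iterate p A mode k) (mode k)) := by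
  simp only [potential_succ_mode, add_sub_cancel_right, kl]

lemma gFun_potential_sub_succ (hp : ∀ j, p j ∈ posSimplex n) (hA : ∀ i, 0 < A i) (k : ℕ) :
    gFun p A (potential p A mode (k + 1)) - gFun p A (potential p A mode (k + 2))
      = ∑ j, ∑ a, p j a * (potential p A mode (k + 2) j a - potential p A mode (k + 1) j a) :=
  gFun_sub_gFun p A _ _
    ((sum_iterate_succ hp hA k).trans (sum_iterate_succ hp hA (k + 1)).symm)

lemma gFun_potential_sub_succ_eq_kl (hp : ∀ j, p j ∈ posSimplex n) (hA : ∀ i, 0 < A i) (k : ℕ) :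
    gFun p A (potential p A mode (k + 1)) - gFun p A (potential p A mode (k + 2))
      = kl (p (mode (k + 1))) (marginal (iterate p A mode (k + 1)) (mode (k + 1))) := by
  rw [gFun_potential_sub_succ hp hA, sum_mul_potential_succ_sub, sum_mode_mul_potential_succ_sub]

lemma sq_dist_potential_succ_le (k : ℕ) :
    dist (potential p A mode k) (potential p A mode (k + 1)) ^ 2
      ≤ ∑ a, (Real.log (p (mode k) a) - Real.log (marginal (iterate p A mode k) (mode k) a)) ^ 2 := by
  set S := ∑ a, (Real.log (p (mode k) a)
    - Real.log (marginal (iterate p A mode k) (mode k) a)) ^ 2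
  have hS : 0 ≤ S := Finset.sum_nonneg fun _ _ => sq_nonneg _
  rw [← Real.le_sqrt dist_nonneg hS, dist_pi_le_iff (Real.sqrt_nonneg _)]
  intro j
  rw [dist_pi_le_iff (Real.sqrt_nonneg _)]
  intro a
  by_cases hj : j = mode k
  · subst hj
    rw [potential_succ_mode, dist_comm, Real.dist_eq, add_sub_cancel_right]
    refine Real.abs_le_sqrt ?_
    exact le_sum_entries (f := fun a => (Real.log (p (mode k) a)
      - Real.log (marginal (iterate p A mode k) (mode k) a)) ^ 2) (fun _ => sq_nonneg _) a
  · rw [potential_succ_of_ne k hj, dist_self]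
    exact Real.sqrt_nonneg _

/-- Bounds for the entries of the iterates, their marginals and the target marginals. -/
lemma exists_lower_bound (hp : ∀ j, p j ∈ posSimplex n) (hA : ∀ i, 0 < A i) :
    ∃ δ, 0 < δ ∧ (∀ k i, δ ≤ iterate p A mode (k + 1) i) ∧
      (∀ k j a, δ ≤ marginal (iterate p A mode (k + 1)) j a) ∧ ∀ j a, δ ≤ p j a := by
  obtain ⟨δ, hδ, h⟩ := exists_pos_le_iterate_succ (mode := mode) hp hA
  obtain ⟨ε, hε, hεp⟩ : ∃ ε, 0 < ε ∧ ∀ x : Fin d × Fin n, ε ≤ p x.1 x.2 := by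
    rcases isEmpty_or_nonempty (Fin d × Fin n) with h | h
    · exact ⟨1, one_pos, fun x => h.elim x⟩
    · obtain ⟨x, hx⟩ := Finite.exists_min fun x : Fin d × Fin n => p x.1 x.2
      exact ⟨p x.1 x.2, (hp _).1 _, hx⟩
  have h' : ∀ k i, min δ ε ≤ iterate p A mode (k + 1) i := fun k i => (min_le_left _ _).trans (h k i)
  exact ⟨min δ ε, lt_min hδ hε, h', fun k => le_marginal (fun i => (iterate_pos hA _ i).le) (h' k),
    fun j a => (min_le_right _ _).trans (hεp (j, a))⟩

theorem exists_potential_convergesGeometrically (hp : ∀ j, p j ∈ posSimplex n)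
    (hA : ∀ i, 0 < A i) (hmode : IsGreedy p A mode) :
    ∃ X, ConvergesGeometrically (potential p A mode) X := by
  obtain ⟨δ, hδ, hit, hmarg, hpδ⟩ := exists_lower_bound (mode := mode) hp hA
  set M := max 2 (-Real.log δ)
  have hM : 2 ≤ M := le_max_left _ _
  have hMδ : -Real.log δ ≤ M := le_max_right _ _
  set G : ℕ → ℝ := fun k => gFun p A (potential p A mode (k + 1))
  set c := 2 * M / δ
  have hc : 0 < c := by positivity
  set S : ℕ → ℝ := fun k => ∑ a, (Real.log (p (mode (k + 1)) a)
    - Real.log (marginal (iterate p A mode (k + 1)) (mode (k + 1)) a)) ^ 2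
  have hsum : ∀ k j, ∑ a, marginal (iterate p A mode (k + 1)) j a = 1 := fun k j => by
    rw [sum_marginal, sum_iterate_succ hp hA]
  have hS : ∀ k, S k ≤ c * (G k - G (k + 1)) := by
    intro k
    simp only [G, gFun_potential_sub_succ_eq_kl hp hA]
    exact sum_sq_log_sub_le_kl hδ hM hMδ (hpδ _) (hmarg k _) (hp _).2 (hsum k _)
  have hanti : Antitone G := by
    refine antitone_nat_of_succ_le fun k => ?_
    have h1 : 0 ≤ S k := Finset.sum_nonneg fun _ _ => sq_nonneg _
    exact sub_nonneg.1 (nonneg_of_mul_nonneg_right (h1.trans (hS k)) hc)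
  set K : ℝ := d * (2 * (1 + n))
  -- `K` comes from the greedy choice and `n` from Cauchy–Schwarz. Since `log` is expanding on `(0,
  -- 1]`, the marginal error is at most the logarithmic one, which is what the step length measures.
  have hdefect : ∀ k, defect p (iterate p A mode (k + 1)) ^ 2 ≤ K ^ 2 * (n * S k) := by
    intro k
    have h1 := defect_le_of_residual_le hp (sum_iterate_succ hp hA k) (hmode (k + 1))
    have h2 : ∑ a, |marginal (iterate p A mode (k + 1)) (mode (k + 1)) a - p (mode (k + 1)) a|
        ≤ ∑ a, |Real.log (p (mode (k + 1)) a)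
          - Real.log (marginal (iterate p A mode (k + 1)) (mode (k + 1)) a)| := by
      refine Finset.sum_le_sum fun a _ => ?_
      rw [abs_sub_comm]
      refine abs_sub_le_abs_log_sub ((hp _).1 a) ?_ (hδ.trans_le (hmarg k _ a)) ?_
      · exact (le_sum_entries (fun a => ((hp _).1 a).le) a).trans_eq (hp _).2
      · exact (le_sum_entries (fun a => hδ.le.trans (hmarg k _ a)) a).trans_eq (hsum k _)
    have h3 : (∑ a, |Real.log (p (mode (k + 1)) a)
          - Real.log (marginal (iterate p A mode (k + 1)) (mode (k + 1)) a)|) ^ 2 ≤ n * S k := by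
      refine (sq_sum_le_card_mul_sum_sq ..).trans_eq ?_
      simp [S]
    have h4 : 0 ≤ defect p (iterate p A mode (k + 1)) :=
      Finset.sum_nonneg fun _ _ => Finset.sum_nonneg fun _ _ => abs_nonneg _
    calc _ ≤ (K * ∑ a, |Real.log (p (mode (k + 1)) a)
          - Real.log (marginal (iterate p A mode (k + 1)) (mode (k + 1)) a)|) ^ 2 := by
          refine pow_le_pow_left₀ h4 (h1.trans ?_) 2
          simp only [K, ← mul_assoc]
          exact mul_le_mul_of_nonneg_left h2 (by positivity)
      _ ≤ _ := by rw [mul_pow]; exact mul_le_mul_of_nonneg_left h3 (sq_nonneg _)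
  obtain ⟨X, C, r, h0, h1, h⟩ := exists_convergesGeometrically_of_descent
    -- In `C₂`, the outer `c` is the gap constant, `K ^ 2 * n` passes from the defect to `S`, and
    -- the inner `c` bounds `S` by the decrease.
    (u := fun k => potential p A mode (k + 1)) (G := G) (C₁ := c) (C₂ := c * (K ^ 2 * (n * c)))
    (fun k => (sq_dist_potential_succ_le _).trans (hS k))
    (fun k m _ => by
      calc G k - G m ≤ c * defect p (iterate p A mode (k + 1)) ^ 2 :=
            gFun_sub_le_sq_defect (fun j => (hp j).2) hA hδ hM hMδ (hit k)
              (sum_iterate_succ hp hA k) (hit m) (sum_iterate_succ hp hA m)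
        _ ≤ c * (K ^ 2 * (n * (c * (G k - G (k + 1))))) := by
            gcongr
            exact (hdefect k).trans (by gcongr; exact hS k)
        _ = _ := by ring) hanti
  exact ⟨X, .of_succ h0 h1 h⟩

end Iteration

end TensorSinkhorn

namespace TensorSinkhorn

variable {n d : ℕ} {p : Fin d → Fin n → ℝ} {A : Tensor n d} {mode : ℕ → Fin d}

/-! ### Identification of the limit and transfer of rates -/

lemma continuous_scale (A : Tensor n d) : Continuous (scale A) := by
  unfold scale
  fun_prop

/-- Entries of the iterates and of the limit are at most 1, where `log` is expanding, so they differ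
by at most the sum of the `d` potential differences. -/
lemma dist_iterate_le (hp : ∀ j, p j ∈ posSimplex n) (hA : ∀ i, 0 < A i) {X : Fin d → Fin n → ℝ}
    (hX : ConvergesGeometrically (potential p A mode) X) (k : ℕ) :
    dist (iterate p A mode (k + 1)) (scale A X)
      ≤ d * dist (potential p A mode (k + 1)) X := by
  have hle : ∀ k i, iterate p A mode (k + 1) i ≤ 1 := fun k i =>
    (le_sum_entries (fun i => (iterate_pos hA _ i).le) i).trans_eq (sum_iterate_succ hp hA k)
  have hlim : Filter.Tendsto (iterate p A mode) Filter.atTop (nhds (scale A X)) :=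
    ((continuous_scale A).tendsto X).comp hX.tendsto
  have hXle : ∀ i, scale A X i ≤ 1 := fun i =>
    le_of_tendsto (((tendsto_pi_nhds.1 hlim) i).comp (Filter.tendsto_add_atTop_nat 1))
      (Filter.Eventually.of_forall fun k => hle k i)
  rw [dist_pi_le_iff (by positivity)]
  intro i
  rw [Real.dist_eq]
  refine (abs_sub_le_abs_log_sub (iterate_pos hA _ i) (hle k i) (scale_pos hA X i)
    (hXle i)).trans ?_
  rw [iterate, log_scale_sub hA]
  refine (Finset.abs_sum_le_sum_abs _ _).trans ?_
  have h : ∀ j ∈ Finset.univ, |(potential p A mode (k + 1) - X) j (i j)|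
      ≤ dist (potential p A mode (k + 1)) X := fun j _ =>
    (dist_le_pi_dist _ _ (i j)).trans (dist_le_pi_dist (potential p A mode (k + 1)) X j)
  simpa using Finset.sum_le_card_nsmul _ _ _ h

/-- Since the steps tend to `0`, so does the largest residual, and the limit has the prescribed
marginals. -/
lemma marginal_scale_eq (hp : ∀ j, p j ∈ posSimplex n) (hA : ∀ i, 0 < A i)
    (hmode : IsGreedy p A mode) {X : Fin d → Fin n → ℝ}
    (hX : ConvergesGeometrically (potential p A mode) X) (j : Fin d) :
    marginal (scale A X) j = p j := by
  have hlim : Filter.Tendsto (iterate p A mode) Filter.atTop (nhds (scale A X)) :=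
    ((continuous_scale A).tendsto X).comp hX.tendsto
  have hstep : Filter.Tendsto (fun k => dist (iterate p A mode (k + 1))
      (iterate p A mode (k + 2))) Filter.atTop (nhds 0) := by
    have := (hlim.comp (Filter.tendsto_add_atTop_nat 1)).dist
      (hlim.comp (Filter.tendsto_add_atTop_nat 2))
    simpa using this
  have hdef : Continuous fun B : Tensor n d => defect p B := by
    unfold defect marginal
    fun_prop
  set N : ℝ := ((Fintype.card (Fin d → Fin n) : ℕ) : ℝ)
  -- The next iterate has exactly the marginal `p` in the chosen mode, so the current error is at
  -- most the `ℓ¹` distance between the two iterates.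
  have hmarg : ∀ k, ∑ a, |marginal (iterate p A mode (k + 1)) (mode (k + 1)) a
      - p (mode (k + 1)) a|
      ≤ N * dist (iterate p A mode (k + 1)) (iterate p A mode (k + 2)) := by
    intro k
    have h : ∑ a, |marginal (iterate p A mode (k + 1)) (mode (k + 1)) a - p (mode (k + 1)) a|
        ≤ ∑ a, marginal (fun i => |iterate p A mode (k + 1) i - iterate p A mode (k + 2) i|)
          (mode (k + 1)) a := by
      refine Finset.sum_le_sum fun a _ => ?_
      rw [← marginal_iterate_succ hp hA (k + 1), marginal, marginal, ← Finset.sum_sub_distrib]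
      exact Finset.abs_sum_le_sum_abs _ _
    rw [sum_marginal] at h
    refine h.trans ?_
    simpa [N, Real.dist_eq] using Finset.sum_le_card_nsmul Finset.univ _ _ fun i _ =>
      dist_le_pi_dist (iterate p A mode (k + 1)) (iterate p A mode (k + 2)) i
  have hzero : defect p (scale A X) ≤ 0 := by
    refine le_of_tendsto_of_tendsto' ((hdef.tendsto _).comp
      (hlim.comp (Filter.tendsto_add_atTop_nat 1)))
      (by simpa using hstep.const_mul (d * (2 * ((1 + n) * N)) : ℝ)) fun k => ?_
    refine (defect_le_of_residual_le hp (sum_iterate_succ hp hA k) (hmode (k + 1))).trans ?_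
    simp only [mul_assoc]
    gcongr
    exact hmarg k
  have h1 : ∑ a, |marginal (scale A X) j a - p j a| ≤ 0 :=
    (le_sum_entries (f := fun j => ∑ a, |marginal (scale A X) j a - p j a|)
      (fun _ => Finset.sum_nonneg fun _ _ => abs_nonneg _) j).trans hzero
  ext a
  have h2 := (le_sum_entries (f := fun a => |marginal (scale A X) j a - p j a|)
    (fun _ => abs_nonneg _) a).trans h1
  exact sub_eq_zero.1 (abs_nonpos_iff.1 h2)

/-- On `[δ, ∞)` the logarithm is Lipschitz with constant `1 / δ`, so the divergence inherits the
rate of the marginals. -/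
lemma kl_marginal_convergesGeometrically (hp : ∀ j, p j ∈ posSimplex n) (hA : ∀ i, 0 < A i)
    {U : Tensor n d} (hU : ∀ j, marginal U j = p j)
    (h : ConvergesGeometrically (iterate p A mode) U) (j : Fin d) :
    ConvergesGeometrically (fun k => kl (p j) (marginal (iterate p A mode k) j)) 0 := by
  obtain ⟨δ, hδ, -, hmarg, hpδ⟩ := exists_lower_bound (mode := mode) hp hA
  set N : ℝ := ((Fintype.card (Fin d → Fin n) : ℕ) : ℝ)
  refine h.of_dist_le (K := N / δ) (by positivity) fun k => ?_
  rw [Real.dist_eq, sub_zero, kl]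
  have h1 : ∀ a, |Real.log (p j a) - Real.log (marginal (iterate p A mode (k + 1)) j a)|
      ≤ N / δ * dist (iterate p A mode (k + 1)) U := by
    intro a
    refine (abs_log_sub_le hδ (hpδ j a) (hmarg k j a)).trans ?_
    rw [div_mul_eq_mul_div]
    gcongr
    rw [abs_sub_comm, ← hU j, marginal, marginal, ← Finset.sum_sub_distrib]
    refine (Finset.abs_sum_le_sum_abs _ _).trans ?_
    refine (Finset.sum_le_univ_sum_of_nonneg fun _ => abs_nonneg _).trans ?_
    simpa [N, Real.dist_eq] using Finset.sum_le_card_nsmul Finset.univ _ _ fun i _ =>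
      dist_le_pi_dist (iterate p A mode (k + 1)) U i
  calc _ ≤ ∑ a, p j a * (N / δ * dist (iterate p A mode (k + 1)) U) := by
        refine (Finset.abs_sum_le_sum_abs _ _).trans (Finset.sum_le_sum fun a _ => ?_)
        rw [abs_mul, abs_of_pos ((hp j).1 a)]
        exact mul_le_mul_of_nonneg_left (h1 a) ((hp j).1 a).le
    _ = _ := by rw [← Finset.sum_mul, (hp j).2, one_mul]

end TensorSinkhorn

open TensorSinkhorn in
theorem mainTheorem2 {n d : ℕ} (p : Fin d → Fin n → ℝ)
    (hp : ∀ j, p j ∈ TensorSinkhorn.posSimplex n)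
    (A : TensorSinkhorn.Tensor n d) (hA : ∀ i, 0 < A i)
    (mode : ℕ → Fin d) (hmode : TensorSinkhorn.IsGreedy p A mode) :
    (∃ U : TensorSinkhorn.Tensor n d,
      U ∈ TensorSinkhorn.transportPolytope p ∧
      TensorSinkhorn.IsScalableTo A U ∧
      (∀ W ∈ TensorSinkhorn.transportPolytope p, TensorSinkhorn.IsScalableTo A W → W = U) ∧
      TensorSinkhorn.ConvergesGeometrically (TensorSinkhorn.iterate p A mode) U) ∧
    (∀ j, TensorSinkhorn.ConvergesGeometrically
      (fun k => TensorSinkhorn.kl (p j)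
        (TensorSinkhorn.marginal (TensorSinkhorn.iterate p A mode k) j)) 0) ∧
    (∃ Xmin : Fin d → Fin n → ℝ,
      (∀ Y, TensorSinkhorn.gFun p A Xmin ≤ TensorSinkhorn.gFun p A Y) ∧
      TensorSinkhorn.ConvergesGeometrically (TensorSinkhorn.potential p A mode) Xmin) ∧
    (∀ k, 1 ≤ k →
      TensorSinkhorn.gFun p A (TensorSinkhorn.potential p A mode k)
          - TensorSinkhorn.gFun p A (TensorSinkhorn.potential p A mode (k + 1))
        = ∑ j, ∑ a, p j a * (TensorSinkhorn.potential p A mode (k + 1) j a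
            - TensorSinkhorn.potential p A mode k j a) ∧
      ∑ j, ∑ a, p j a * (TensorSinkhorn.potential p A mode (k + 1) j a
            - TensorSinkhorn.potential p A mode k j a)
        = ∑ a, p (mode k) a * (TensorSinkhorn.potential p A mode (k + 1) (mode k) a
            - TensorSinkhorn.potential p A mode k (mode k) a) ∧
      ∑ a, p (mode k) a * (TensorSinkhorn.potential p A mode (k + 1) (mode k) a
            - TensorSinkhorn.potential p A mode k (mode k) a)
        = TensorSinkhorn.kl (p (mode k))
            (TensorSinkhorn.marginal (TensorSinkhorn.iterate p A mode k) (mode k))) := by 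
  obtain ⟨X, hX⟩ := exists_potential_convergesGeometrically hp hA hmode
  have hXp := marginal_scale_eq hp hA hmode hX
  have hU := hX.of_dist_le (Nat.cast_nonneg d) (dist_iterate_le hp hA hX)
  refine ⟨⟨scale A X, ⟨fun i => (scale_pos hA X i).le, hXp⟩, ⟨X, rfl⟩, ?_, hU⟩,
    kl_marginal_convergesGeometrically hp hA hXp hU, ⟨X, gFun_le_of_marginal_eq hA hXp, hX⟩, ?_⟩
  · rintro _ ⟨-, hW⟩ ⟨Y, rfl⟩
    exact scale_eq_of_marginal_eq hA fun j => (hW j).trans (hXp j).symm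
  · intro k hk
    obtain ⟨k, rfl⟩ := Nat.exists_eq_add_of_le' hk
    exact ⟨gFun_potential_sub_succ hp hA k, sum_mul_potential_succ_sub _,
      sum_mode_mul_potential_succ_sub _⟩
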